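/- Let $\mathcal A=(Q,\delta,I,F)$ be a complete nondeterministic Büchi automaton over a finite nonempty alphabet $\Sigma$, i.e. $Q$ is a finite set of states, $n=|Q|$, $\delta:Q\times\Sigma\to 2^Q$ with $\delta(q,a)\neq\emptyset$ for all $q\in Q$, $a\in\Sigma$, and $I,F\subseteq Q$. For $P\subseteq Q$ let $\delta(P,a)=\bigcup_{p\in P}\delta(p,a)$. A word $\alpha\in\Sigma^\omega$ is in $\mathcal L(\mathcal A)$ iff there is a sequence $\rho_0\rho_1\dots$ of states with $\rho_0\in I$ and $\rho_{j+1}\in\delta(\rho_j,\alpha_j)$ for all $j$ in which some state of $F$ occurs infinitely often. Delayed simulation: a strategy is a map $\sigma:Q\times(Q\times\Sigma\times Q)\to Q$ with $\sigma(r,(p,a,p'))\in\delta(r,a)$. We write $p\preceq_{de}r$ iff there is a strategy $\sigma$ such that for all words $\alpha$ and all $p_0p_1\dots$ with $p_0=p$ and $p_{j+1}\in\delta(p_j,\alpha_j)$ for all $j$, the sequence $r_0=r$, $r_{j+1}=\sigma(r_j,(p_j,\alpha_j,p_{j+1}))$ satisfies: for every $j$ with $p_j\in F$ there is $k\ge j$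 with $r_k\in F$. A level ranking is a function $f:Q\to\{0,\dots,2n\}$ with $f(q)$ even for all $q\in F$; its rank is $\operatorname{rank}(f)=\max_{q\in Q} f(q)$ (no ranking is considered tight if $Q=\emptyset$). For $S\subseteq Q$, $f$ is $S$-tight iff $r=\operatorname{rank}(f)$ is odd, $\{1,3,\dots,r\}\subseteq f(S)$, and $f(q)=0$ for all $q\notin S$. Let $\mathcal T$ be the set of $Q$-tight rankings. Let $$Q_2=\{(S,O,f,i)\in 2^Q\times 2^Q\times\mathcal T\times\{0,2,\dots,2n-2\}\mid f\text{ is }S\text{-tight},\ O\subseteq S\cap f^{-1}(i)\}.$$ For $R\subseteq Q_2$ let $\mathcal B_R$ be the Büchi automaton with set of states $2^Q\cup R$, the only initial state $I\in 2^Q$, accepting states $\emptyset\in 2^Q$ and all $(S,\emptyset,f,i)\in R$, and exactly the following transitions over $a\in\Sigma$: 1. $S\to\delta(S,a)$ for $S\in 2^Q$; 2. $S\to(S',\emptyset,f,0)\in R$ for $S\in 2^Q$, $S'=\delta(S,a)$ and $f$ $S'$-tight; 3. $(S,O,f,i)\to(S',O',f',i')$, both in $R$, if $S'=\delta(S,a)$,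 $f'(q')\le f(q)$ for all $q\in S$ and $q'\in\delta(q,a)$, $\operatorname{rank}(f)=\operatorname{rank}(f')$, $f'$ is $S'$-tight, and either $O=\emptyset$, $i'=(i+2)\bmod(\operatorname{rank}(f')+1)$ and $O'=S'\cap f'^{-1}(i')$, or $O\ne\emptyset$, $i'=i$ and $O'=\delta(O,a)\cap f'^{-1}(i)$. Schewe's complement is $\mathcal B_{Q_2}$. Let $Q_2^{de}$ be the set of all $(S,O,f,i)\in Q_2$ for which there are no $p,q\in S$ with $p\preceq_{de}q$ and $f(p)>\lceil\!\lceil f(q)\rceil\!\rceil$, where $\lceil\!\lceil x\rceil\!\rceil$ is the smallest even number $\ge x$. Then $$\mathcal L(\mathcal B_{Q_2^{de}})=\mathcal L(\mathcal B_{Q_2})\qquad\text{and}\qquad \mathcal L(\mathcal B_{Q_2^{de}})=\Sigma^\omega\setminus\mathcal L(\mathcal A).$$ -/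

import Mathlib

/-- A nondeterministic Büchi automaton over the alphabet `α` with finite state set `Q`. -/
structure BA (α : Type*) (Q : Type*) where
  /-- the state set is finite -/
  finite : Finite Q
  /-- the transition function -/
  δ : Q → α → Set Q
  /-- the initial states -/
  I : Set Q
  /-- the accepting states -/
  F : Set Q

/-- The tuples `(S, O, f, i)` from which the macrostates are taken. -/
@[ext]
structure RankState (Q : Type*) where
  S : Set Q
  O : Set Q
  f : Q → ℕ
  i : ℕ

/-- The smallest even number that is greater than or equal to `x`. -/
def evenCeil (x : ℕ) : ℕ := if Even x then x else x + 1

/-- The rank of `f`, i.e. the maximum of `f` (used for functions on a finite type). -/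
noncomputable def rankOf {Q : Type*} (f : Q → ℕ) : ℕ := ⨆ q, f q

namespace BA

variable {α Q : Type*}

/-- Every state has a successor over every symbol. -/
def Complete (A : BA α Q) : Prop := ∀ q a, (A.δ q a).Nonempty

/-- The transition function extended to sets of states. -/
def post (A : BA α Q) (P : Set Q) (a : α) : Set Q := ⋃ p ∈ P, A.δ p a

/-- `ρ` respects the transition function along the infinite word `w`. -/
def IsTrace (A : BA α Q) (w : ℕ → α) (ρ : ℕ → Q) : Prop :=
  ∀ j, ρ (j + 1) ∈ A.δ (ρ j) (w j)

/-- `ρ` visits some accepting state infinitely often. -/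
def IsAccepting (A : BA α Q) (ρ : ℕ → Q) : Prop :=
  ∃ q ∈ A.F, {j | ρ j = q}.Infinite

/-- The language of a state. -/
def langFrom (A : BA α Q) (q : Q) : Set (ℕ → α) :=
  {w | ∃ ρ : ℕ → Q, ρ 0 = q ∧ A.IsTrace w ρ ∧ A.IsAccepting ρ}

/-- The language of the automaton. -/
def lang (A : BA α Q) : Set (ℕ → α) := ⋃ q ∈ A.I, A.langFrom q

/-! ### Delayed simulation -/

/-- A strategy of Duplicator: `σ r p a p'` is the answer in state `r` to the move
from `p` to `p'` over `a` of Spoiler. -/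
def IsStrategy (A : BA α Q) (σ : Q → Q → α → Q → Q) : Prop :=
  ∀ r p a p', σ r p a p' ∈ A.δ r a

/-- The states that Duplicator visits when starting in `r` and answering with `σ` to the
trace `π` over `w` of Spoiler. -/
def respond (σ : Q → Q → α → Q → Q) (r : Q) (w : ℕ → α) (π : ℕ → Q) : ℕ → Q
  | 0 => r
  | j + 1 => σ (respond σ r w π j) (π j) (w j) (π (j + 1))

/-- The strategy `σ` wins the delayed simulation game from `(p, r)`. -/
def WinsDelayed (A : BA α Q) (σ : Q → Q → α → Q → Q) (p r : Q) : Prop :=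
  ∀ (w : ℕ → α) (π : ℕ → Q), π 0 = p → A.IsTrace w π →
    ∀ j, π j ∈ A.F → ∃ k, j ≤ k ∧ respond σ r w π k ∈ A.F

/-- `p` is delay-simulated by `r`. -/
def DelayedSim (A : BA α Q) (p r : Q) : Prop :=
  ∃ σ, A.IsStrategy σ ∧ A.WinsDelayed σ p r

/-! ### Rankings and macrostates -/

/-- The level rankings: functions to `{0, …, 2n}`, `n` the number of states, that are even on
accepting states. -/
def IsRanking (A : BA α Q) (f : Q → ℕ) : Prop :=
  (∀ q, f q ≤ 2 * Nat.card Q) ∧ ∀ q ∈ A.F, Even (f q)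

/-- `f` is an `S`-tight level ranking. -/
structure IsTight (A : BA α Q) (S : Set Q) (f : Q → ℕ) : Prop where
  isRanking : A.IsRanking f
  odd_rank : Odd (rankOf f)
  odd_subset : {k | Odd k ∧ k ≤ rankOf f} ⊆ f '' S
  eq_zero : ∀ q, q ∉ S → f q = 0

/-- The ranking `f'` does not exceed `f` along transitions from `S` over `a`. -/
def RankLE (A : BA α Q) (S : Set Q) (a : α) (f' f : Q → ℕ) : Prop :=
  ∀ q ∈ S, ∀ q' ∈ A.δ q a, f' q' ≤ f q

/-- The macrostates with a ranking, of Schewe's construction. -/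
def Q2 (A : BA α Q) : Set (RankState Q) :=
  {M | A.IsTight Set.univ M.f ∧ Even M.i ∧ M.i < 2 * Nat.card Q ∧
    A.IsTight M.S M.f ∧ M.O ⊆ M.S ∩ M.f ⁻¹' {M.i}}

/-- The macrostates to be removed. -/
def RemDelayed (A : BA α Q) (M : RankState Q) : Prop :=
  ∃ p ∈ M.S, ∃ q ∈ M.S, A.DelayedSim p q ∧ evenCeil (M.f q) < M.f p

/-- The macrostates with a ranking that remain. -/
def Q2de (A : BA α Q) : Set (RankState Q) := A.Q2 \ {M | A.RemDelayed M}

/-- Transitions from the subset part to the part with rankings. -/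
def Step2 (A : BA α Q) (S : Set Q) (a : α) (M' : RankState Q) : Prop :=
  M'.S = A.post S a ∧ M'.O = ∅ ∧ M'.i = 0 ∧ A.IsTight M'.S M'.f

/-- Transitions within the part with rankings. -/
def Step3 (A : BA α Q) (M : RankState Q) (a : α) (M' : RankState Q) : Prop :=
  M'.S = A.post M.S a ∧ A.RankLE M.S a M'.f M.f ∧ rankOf M.f = rankOf M'.f ∧
    A.IsTight M'.S M'.f ∧
    ((M.O = ∅ ∧ M'.i = (M.i + 2) % (rankOf M'.f + 1) ∧ M'.O = M'.S ∩ M'.f ⁻¹' {M'.i}) ∨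
     (M.O ≠ ∅ ∧ M'.i = M.i ∧ M'.O = A.post M.O a ∩ M'.f ⁻¹' {M.i}))

theorem finite_Q2 (A : BA α Q) : A.Q2.Finite := by
  have := A.finite
  let g : Set Q × Set Q × (Q → Fin (2 * Nat.card Q + 1)) × Fin (2 * Nat.card Q) → RankState Q :=
    fun x => ⟨x.1, x.2.1, fun q => x.2.2.1 q, x.2.2.2⟩
  refine (Set.finite_range g).subset ?_
  rintro ⟨S, O, f, i⟩ ⟨hf, -, hi, -, -⟩
  exact ⟨(S, O, fun q => ⟨f q, Nat.lt_succ_of_le (hf.isRanking.1 q)⟩, ⟨i, hi⟩), rfl⟩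

/-- The rank-based construction in which the set `R` is used for the macrostates with a ranking.
The states are the subsets of `Q` and the elements of `R`. -/
def rankConstruction (A : BA α Q) (R : Set (RankState Q)) (hR : R ⊆ A.Q2) :
    BA α (Set Q ⊕ R) where
  finite := by
    have := A.finite
    have := (A.finite_Q2.subset hR).to_subtype
    infer_instance
  δ
    | .inl S, a => {X | match X with
        | .inl S' => S' = A.post S a
        | .inr M' => A.Step2 S a M'}
    | .inr M, a => {X | match X with
        | .inl _ => False
        | .inr M' => A.Step3 M a M'}
  I := {.inl A.I}
  F := {X | match X with
    | .inl S => S = ∅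
    | .inr M => M.1.O = ∅}

/-- Schewe's rank-based complement of `A`. -/
def schewe (A : BA α Q) : BA α (Set Q ⊕ A.Q2) :=
  A.rankConstruction A.Q2 Set.Subset.rfl

/-- Schewe's construction purged by means of delayed simulation. -/
def purgeDe (A : BA α Q) : BA α (Set Q ⊕ A.Q2de) :=
  A.rankConstruction A.Q2de Set.sdiff_subset

end BA

/-!
The core of the argument is that `A.rankConstruction R` recognizes the complement of `A.lang` for
every `R` with `A.Q2de ⊆ R ⊆ A.Q2` (`BA.rankConstruction_lang`).

*Accepted words are rejected.* Along an accepting run of `A` the ranks given by the macrostates do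
not increase, so they stabilize, at an even number `c` because accepting states have even rank. If
`O` is emptied infinitely often, then `i` cycles through all even numbers below the rank
(`BA.exists_reset`), so at some moment `i = c` and the run is put into `O`, which it never leaves
(`BA.not_frequently_empty`).

*Rejected words are accepted.* The rankings are the ranks of Kupferman and Vardi in the run graph
of the word (`BA.runRank`), defined by peeling off alternately the vertices without infinite paths
and the vertices that reach no accepting state. For a rejected word, each nonempty odd graph of
the peeling has an infinite path of vertices that reach no accepting state, so all odd ranks up to
the maximal one occur on all late levels. With König's lemma this yields tight rankings of constant
rank (`BA.exists_isTight_runRank`). Again by König's lemma `O` is emptied infinitely often, since no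
path has constant even rank.

*Delayed simulation.* The ranks automatically respect it: if `q` delay-simulates `p`, and `p`
survives up to the odd graph `2 * i + 1`, then so does `q` (`BA.WinsDelayed.mem_peel`, by induction
on `i`). Indeed Spoiler can stay in that odd graph. Were the answer at some moment outside the even
graph `2 * i`, Spoiler could move to an accepting state within the odd graph `2 * i - 1` and stay
there. By induction the answers are in that graph as well, and one of them has to be accepting,
which puts all the earlier answers into the even graph `2 * i`. Hence the run through the canonical
ranks never uses a macrostate that the purge removes.
-/

namespace BA

variable {α Q : Type*}

/-! ### The run graph and its peeling -/

/-- The states of `A` that are reachable by the prefix of length `j` of `w`: the vertices on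
level `j` of the run graph of `w`. -/
def level (A : BA α Q) (w : ℕ → α) : ℕ → Set Q
  | 0 => A.I
  | j + 1 => A.post (A.level w j) (w j)

/-- From index `j` on, `ρ` is a path through the run graph of `w` with all vertices in `X`. Paths
are indexed by the levels they visit, so the values `ρ k` for `k < j` are irrelevant. -/
def IsPathIn (A : BA α Q) (w : ℕ → α) (X : ℕ → Set Q) (j : ℕ) (ρ : ℕ → Q) : Prop :=
  ∀ k, j ≤ k → ρ k ∈ X k ∧ ρ (k + 1) ∈ A.δ (ρ k) (w k)

/-- The vertices from which an infinite path within `X` starts. -/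
def infinitePart (A : BA α Q) (w : ℕ → α) (X : ℕ → Set Q) (j : ℕ) : Set Q :=
  {q | ∃ ρ : ℕ → Q, ρ j = q ∧ A.IsPathIn w X j ρ}

/-- `A.ReachesIn w X T n j q`: from `q` on level `j` a path of length `n` within `X` leads to an
element of `T`. -/
def ReachesIn (A : BA α Q) (w : ℕ → α) (X : ℕ → Set Q) (T : Set Q) : ℕ → ℕ → Q → Prop
  | 0, j, q => q ∈ X j ∧ q ∈ T
  | n + 1, j, q => q ∈ X j ∧ ∃ q' ∈ A.δ q (w j), ReachesIn A w X T n (j + 1) q'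

/-- The vertices from which an accepting state can be reached within `X`. -/
def livePart (A : BA α Q) (w : ℕ → α) (X : ℕ → Set Q) (j : ℕ) : Set Q :=
  {q | ∃ n, A.ReachesIn w X A.F n j q}

open Classical in
/-- The decreasing sequence of subgraphs of the run graph that defines the ranks of Kupferman and
Vardi: alternately, the vertices without an infinite path and the vertices that reach no accepting
state are removed. -/
noncomputable def peel (A : BA α Q) (w : ℕ → α) : ℕ → ℕ → Set Q
  | 0 => A.level w
  | k + 1 => if Even k then A.infinitePart w (A.peel w k) else A.livePart w (A.peel w k)

/-- The rank of a vertex of the run graph: the number of peeling steps that it survives. It is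
`0` for states outside the run graph. -/
noncomputable def runRank (A : BA α Q) (w : ℕ → α) (j : ℕ) (q : Q) : ℕ :=
  sInf {k | q ∉ A.peel w (k + 1) j}

variable {A : BA α Q} {w : ℕ → α}

theorem peel_odd (i : ℕ) : A.peel w (2 * i + 1) = A.infinitePart w (A.peel w (2 * i)) := by
  simp [peel]

theorem peel_even (i : ℕ) : A.peel w (2 * i + 2) = A.livePart w (A.peel w (2 * i + 1)) := by
  rw [peel, if_neg (by simp)]

theorem infinitePart_subset (X : ℕ → Set Q) (j : ℕ) : A.infinitePart w X j ⊆ X j := by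
  rintro _ ⟨ρ, rfl, h⟩
  exact (h j le_rfl).1

theorem ReachesIn.mem {X : ℕ → Set Q} {T : Set Q} {n j : ℕ} {q : Q}
    (h : A.ReachesIn w X T n j q) : q ∈ X j := by
  cases n <;> exact h.1

theorem peel_succ_subset (k j : ℕ) : A.peel w (k + 1) j ⊆ A.peel w k j := by
  rw [peel]
  split_ifs
  · exact infinitePart_subset _ _
  · rintro q ⟨n, h⟩
    exact h.mem

theorem peel_antitone (j : ℕ) : Antitone fun k => A.peel w k j :=
  antitone_nat_of_succ_le fun k => peel_succ_subset k j

theorem peel_subset_level (k j : ℕ) : A.peel w k j ⊆ A.level w j :=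
  peel_antitone j (Nat.zero_le k)

theorem mem_level_succ {j : ℕ} {q q' : Q} (hq : q ∈ A.level w j) (h : q' ∈ A.δ q (w j)) :
    q' ∈ A.level w (j + 1) :=
  Set.mem_biUnion hq h

theorem exists_mem_of_mem_level_succ {j : ℕ} {q' : Q} (h : q' ∈ A.level w (j + 1)) :
    ∃ q ∈ A.level w j, q' ∈ A.δ q (w j) := by
  simpa [level, post] using h

theorem mem_infinitePart_of_succ {X : ℕ → Set Q} {j : ℕ} {q q' : Q} (hq : q ∈ X j)
    (h : q' ∈ A.δ q (w j)) (hq' : q' ∈ A.infinitePart w X (j + 1)) :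
    q ∈ A.infinitePart w X j := by
  obtain ⟨ρ, rfl, hρ⟩ := hq'
  refine ⟨Function.update ρ j q, by simp, fun k hk => ?_⟩
  rcases hk.eq_or_lt with rfl | hk
  · simpa using ⟨hq, h⟩
  · have := hρ k hk
    rwa [Function.update_of_ne (by lia), Function.update_of_ne (by lia)]

/-- Within the run graph, the peeled graphs are closed under predecessors. -/
theorem mem_peel_of_succ (k : ℕ) {j : ℕ} {q q' : Q} (hq : q ∈ A.level w j)
    (h : q' ∈ A.δ q (w j)) (hq' : q' ∈ A.peel w k (j + 1)) : q ∈ A.peel w k j := by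
  induction k with
  | zero => exact hq
  | succ k ih =>
    have hqk := ih (peel_succ_subset k _ hq')
    rw [peel] at hq' ⊢
    split_ifs at hq' ⊢
    · exact mem_infinitePart_of_succ hqk h hq'
    · obtain ⟨n, hn⟩ := hq'
      exact ⟨n + 1, hqk, q', h, hn⟩

theorem mem_level_of_path {j : ℕ} {ρ : ℕ → Q} (h0 : ρ j ∈ A.level w j)
    (hρ : ∀ k, j ≤ k → ρ (k + 1) ∈ A.δ (ρ k) (w k)) {k : ℕ} (hk : j ≤ k) :
    ρ k ∈ A.level w k := by
  induction k, hk using Nat.le_induction with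
  | base => exact h0
  | succ k hk ih => exact mem_level_succ ih (hρ k hk)

theorem mem_peel_of_path (m : ℕ) {j : ℕ} {ρ : ℕ → Q} (h0 : ρ j ∈ A.level w j)
    (hρ : ∀ k, j ≤ k → ρ (k + 1) ∈ A.δ (ρ k) (w k)) {k : ℕ} (hk : j ≤ k)
    (h : ρ k ∈ A.peel w m k) : ρ j ∈ A.peel w m j := by
  induction k, hk using Nat.le_induction with
  | base => exact h
  | succ k hk ih => exact ih (mem_peel_of_succ m (mem_level_of_path h0 hρ hk) (hρ k hk) h)

theorem IsPathIn.mono {X : ℕ → Set Q} {j k : ℕ} {ρ : ℕ → Q} (h : A.IsPathIn w X j ρ)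
    (hk : j ≤ k) : A.IsPathIn w X k ρ :=
  fun l hl => h l (hk.trans hl)

/-- A path witnessing membership in the infinite part never leaves the infinite part. -/
theorem exists_path_infinitePart {X : ℕ → Set Q} {j : ℕ} {q : Q}
    (h : q ∈ A.infinitePart w X j) :
    ∃ ρ : ℕ → Q, ρ j = q ∧ A.IsPathIn w (A.infinitePart w X) j ρ := by
  obtain ⟨ρ, h0, hρ⟩ := h
  exact ⟨ρ, h0, fun k hk => ⟨⟨ρ, rfl, hρ.mono hk⟩, (hρ k hk).2⟩⟩

/-- A finite path within an infinite part to an element of `T` extends to an infinite one. -/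
theorem ReachesIn.exists_path {X : ℕ → Set Q} {T : Set Q} {n j : ℕ} {q : Q}
    (h : A.ReachesIn w (A.infinitePart w X) T n j q) :
    ∃ ρ : ℕ → Q, ρ j = q ∧ ρ (j + n) ∈ T ∧ A.IsPathIn w (A.infinitePart w X) j ρ := by
  induction n generalizing j q with
  | zero =>
    obtain ⟨ρ, h0, hρ⟩ := exists_path_infinitePart h.1
    exact ⟨ρ, h0, by simpa [h0] using h.2, hρ⟩
  | succ n ih =>
    obtain ⟨hq, q', hq', hn⟩ := h
    obtain ⟨ρ, rfl, hT, hρ⟩ := ih hn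
    refine ⟨Function.update ρ j q, by simp, ?_, fun k hk => ?_⟩
    · rwa [Function.update_of_ne (by lia), show j + (n + 1) = j + 1 + n by lia]
    · rcases hk.eq_or_lt with rfl | hk
      · simpa using ⟨hq, hq'⟩
      · have := hρ k hk
        rwa [Function.update_of_ne (by lia), Function.update_of_ne (by lia)]

/-- Dependent choice along the levels from `j` on. -/
theorem exists_seq_of_step {P : ℕ → Q → Prop} {R : ℕ → Q → Q → Prop} {j : ℕ} {q : Q}
    (h0 : P j q) (hs : ∀ k q, j ≤ k → P k q → ∃ q', P (k + 1) q' ∧ R k q q') :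
    ∃ ρ : ℕ → Q, ρ j = q ∧ ∀ k, j ≤ k → P k (ρ k) ∧ R k (ρ k) (ρ (k + 1)) := by
  choose! g hg using hs
  let s : ℕ → Q := fun n => Nat.rec q (fun n x => g (j + n) x) n
  have hP : ∀ n, P (j + n) (s n) := fun n => by
    induction n with
    | zero => exact h0
    | succ n ih => exact (hg (j + n) (s n) (by lia) ih).1
  refine ⟨fun k => s (k - j), by simp [s], fun k hk => ?_⟩
  obtain ⟨n, rfl⟩ := Nat.exists_eq_add_of_le hk
  have h1 : j + n + 1 - j = n + 1 := by lia
  simp only [Nat.add_sub_cancel_left, h1]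
  exact ⟨hP n, (hg (j + n) (s n) (by lia) (hP n)).2⟩

theorem ReachesIn.antitone {X : ℕ → Set Q} {m n j : ℕ} {q : Q} (hmn : m ≤ n)
    (h : A.ReachesIn w X Set.univ n j q) : A.ReachesIn w X Set.univ m j q := by
  induction m generalizing n j q with
  | zero => exact ⟨h.mem, trivial⟩
  | succ m ih =>
    obtain ⟨n, rfl⟩ : ∃ k, n = k + 1 := ⟨n - 1, by lia⟩
    obtain ⟨hq, q', hq', hn⟩ := h
    exact ⟨hq, q', hq', ih (by lia) hn⟩

/-- In a finite type, arbitrarily long paths from some element of `T` yield an element of `T` from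
which there are paths of every length. -/
theorem exists_forall_reachesIn {X : ℕ → Set Q} {T : Set Q} {j : ℕ}
    (h : ∀ n, ∃ q ∈ T, A.ReachesIn w X Set.univ n j q) :
    ∃ q ∈ T, ∀ n, A.ReachesIn w X Set.univ n j q := by
  have := A.finite
  choose g hg hr using h
  obtain ⟨q, hq⟩ := Finite.exists_infinite_fiber g
  rw [Set.infinite_coe_iff] at hq
  obtain ⟨n, hn⟩ := hq.nonempty
  refine ⟨q, hn ▸ hg n, fun m => ?_⟩
  obtain ⟨l, hl, hml⟩ := hq.exists_gt m
  have := hr l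
  rw [show g l = q from hl] at this
  exact this.antitone hml.le

/-- König's lemma, for a sequence of nonempty sets closed under taking some predecessor. -/
theorem exists_path_of_forall_nonempty {X : ℕ → Set Q} {j : ℕ}
    (hne : ∀ k, j ≤ k → (X k).Nonempty)
    (hpred : ∀ k, j ≤ k → ∀ q' ∈ X (k + 1), ∃ q ∈ X k, q' ∈ A.δ q (w k)) :
    ∃ ρ : ℕ → Q, A.IsPathIn w X j ρ := by
  have hlong : ∀ n k, j ≤ k → ∃ q ∈ Set.univ, A.ReachesIn w X Set.univ n k q := fun n => by
    induction n with
    | zero => exact fun k hk => (hne k hk).imp fun q hq => ⟨trivial, hq, trivial⟩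
    | succ n ih =>
      intro k hk
      obtain ⟨q', -, hq'⟩ := ih (k + 1) (by lia)
      obtain ⟨q, hq, hqq'⟩ := hpred k hk q' hq'.mem
      exact ⟨q, trivial, hq, q', hqq', hq'⟩
  obtain ⟨q, -, hq⟩ := exists_forall_reachesIn fun n => hlong n j le_rfl
  obtain ⟨ρ, -, hρ⟩ := exists_seq_of_step (P := fun k q => ∀ n, A.ReachesIn w X Set.univ n k q)
    (R := fun k q q' => q' ∈ A.δ q (w k)) hq fun k q _ hq => by
      obtain ⟨q', h1, h2⟩ := exists_forall_reachesIn (T := A.δ q (w k)) fun n => (hq (n + 1)).2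
      exact ⟨q', h2, h1⟩
  exact ⟨ρ, fun k hk => ⟨((hρ k hk).1 0).mem, (hρ k hk).2⟩⟩

/-! ### Ranks of a rejected word -/

/-- Every path through the run graph extends backwards to a run from an initial state. -/
theorem exists_trace_of_path {j : ℕ} {ρ : ℕ → Q} (h0 : ρ j ∈ A.level w j)
    (hρ : ∀ k, j ≤ k → ρ (k + 1) ∈ A.δ (ρ k) (w k)) :
    ∃ ρ' : ℕ → Q, ρ' 0 ∈ A.I ∧ A.IsTrace w ρ' ∧ ∀ k, j ≤ k → ρ' k = ρ k := by
  induction j generalizing ρ with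
  | zero => exact ⟨ρ, h0, fun k => hρ k k.zero_le, fun _ _ => rfl⟩
  | succ j ih =>
    obtain ⟨q, hq, hqq'⟩ := exists_mem_of_mem_level_succ h0
    obtain ⟨ρ', h1, h2, h3⟩ := ih (ρ := Function.update ρ j q) (by simpa using hq)
      fun k hk => by
        rcases hk.eq_or_lt with rfl | hk
        · simpa using hqq'
        · rw [Function.update_of_ne (by lia), Function.update_of_ne (by lia)]
          exact hρ k hk
    refine ⟨ρ', h1, h2, fun k hk => ?_⟩
    rw [h3 k (by lia), Function.update_of_ne (by lia)]

/-- Over a finite state set, visiting accepting states infinitely often suffices. -/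
theorem isAccepting_of_frequently {ρ : ℕ → Q} (h : ∀ k, ∃ l, k ≤ l ∧ ρ l ∈ A.F) :
    A.IsAccepting ρ := by
  have := A.finite
  choose g hg hF using h
  obtain ⟨q, hq⟩ := Finite.exists_infinite_fiber fun k => ρ (g k)
  rw [Set.infinite_coe_iff] at hq
  obtain ⟨k, hk⟩ := hq.nonempty
  refine ⟨q, by rw [← show ρ (g k) = q from hk]; exact hF k, ?_⟩
  refine Set.infinite_of_forall_exists_gt fun n => ?_
  obtain ⟨m, hm, hnm⟩ := hq.exists_gt n
  exact ⟨g m, hm, hnm.trans_le (hg m)⟩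

theorem IsAccepting.frequently {ρ : ℕ → Q} (h : A.IsAccepting ρ) (k : ℕ) :
    ∃ l, k ≤ l ∧ ρ l ∈ A.F := by
  obtain ⟨q, hq, hinf⟩ := h
  obtain ⟨l, hl, hkl⟩ := hinf.exists_gt k
  exact ⟨l, hkl.le, by rw [show ρ l = q from hl]; exact hq⟩

/-- If every vertex of a nonempty infinite part of the run graph reaches an accepting state within
it, then the word is accepted. -/
theorem mem_lang_of_subset_livePart {X : ℕ → Set Q} (hX : ∀ k, X k ⊆ A.level w k)
    (hlive : ∀ k, A.infinitePart w X k ⊆ A.livePart w (A.infinitePart w X) k)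
    {j : ℕ} {q : Q} (hq : q ∈ A.infinitePart w X j) : w ∈ A.lang := by
  classical
  set Y := A.infinitePart w X with hY
  -- The distance to the nearest accepting state; it is decreased as long as it is positive.
  let d : ℕ → Q → ℕ := fun k q => sInf {n | A.ReachesIn w Y A.F n k q}
  have hd : ∀ k, ∀ q ∈ Y k, A.ReachesIn w Y A.F (d k q) k q := fun k q hq =>
    Nat.sInf_mem (hlive k hq)
  obtain ⟨ρ, h0, hρ⟩ := exists_seq_of_step (P := fun k q => q ∈ Y k)
    (R := fun k q q' => q' ∈ A.δ q (w k) ∧ (q ∈ A.F ∨ d (k + 1) q' < d k q)) hq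
    fun k q _ hq => by
      have hr := hd k q hq
      cases hn : d k q with
      | zero =>
        rw [hn] at hr
        obtain ⟨ρ, rfl, hρ⟩ := exists_path_infinitePart hq
        exact ⟨ρ (k + 1), (hρ (k + 1) (by lia)).1, (hρ k le_rfl).2, .inl hr.2⟩
      | succ n =>
        rw [hn] at hr
        obtain ⟨-, q', hq', hr'⟩ := hr
        exact ⟨q', hr'.mem, hq', .inr (Nat.lt_succ_of_le (Nat.sInf_le hr'))⟩
  have hfreq : ∀ n k, j ≤ k → d k (ρ k) ≤ n → ∃ l, k ≤ l ∧ ρ l ∈ A.F := fun n => by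
    induction n with
    | zero =>
      intro k hk hn
      rcases (hρ k hk).2.2 with h | h
      · exact ⟨k, le_rfl, h⟩
      · lia
    | succ n ih =>
      intro k hk hn
      rcases (hρ k hk).2.2 with h | h
      · exact ⟨k, le_rfl, h⟩
      · obtain ⟨l, hl, hF⟩ := ih (k + 1) (by lia) (by lia)
        exact ⟨l, by lia, hF⟩
  obtain ⟨ρ', h1, h2, h3⟩ := exists_trace_of_path (ρ := ρ) (j := j) (w := w) (A := A)
    (by rw [h0]; exact hX j (infinitePart_subset _ _ hq)) fun k hk => (hρ k hk).2.1
  refine Set.mem_biUnion h1 ⟨ρ', rfl, h2, isAccepting_of_frequently fun k => ?_⟩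
  obtain ⟨l, hl, hF⟩ := hfreq _ (max j k) (le_max_left _ _) le_rfl
  exact ⟨l, (le_max_right _ _).trans hl, by rw [h3 l ((le_max_left _ _).trans hl)]; exact hF⟩

/-- For a rejected word, if the odd graph number `2 * i + 1` is nonempty, then from some level on
every level has a vertex of rank `2 * i + 1`. -/
theorem exists_forall_mem_peel_diff (hw : w ∉ A.lang) (i : ℕ)
    (h : ∃ j, (A.peel w (2 * i + 1) j).Nonempty) :
    ∃ L, ∀ l, L ≤ l → ∃ q ∈ A.peel w (2 * i + 1) l, q ∉ A.peel w (2 * i + 2) l := by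
  obtain ⟨j, q, hq⟩ := h
  obtain ⟨L, p, hp, hp'⟩ : ∃ L, ∃ p ∈ A.peel w (2 * i + 1) L, p ∉ A.peel w (2 * i + 2) L := by
    by_contra! hcon
    rw [peel_even, peel_odd] at hcon
    rw [peel_odd] at hq
    exact hw (mem_lang_of_subset_livePart (peel_subset_level _) hcon hq)
  refine ⟨L, fun l hl => ?_⟩
  have hp1 := hp
  rw [peel_odd] at hp1
  obtain ⟨ρ, rfl, hρ⟩ := exists_path_infinitePart hp1
  rw [← peel_odd] at hρ
  exact ⟨ρ l, (hρ l hl).1, fun h => hp' (mem_peel_of_path _ (peel_subset_level _ _ hp)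
    (fun k hk => (hρ k hk).2) hl h)⟩

/-- The peeling of the run graph of a rejected word ends after `2 * n` steps: each odd graph that
is nonempty contributes a vertex of its own to all late levels. -/
theorem peel_eq_empty (hw : w ∉ A.lang) (j : ℕ) : A.peel w (2 * Nat.card Q + 1) j = ∅ := by
  have := A.finite
  by_contra! hne
  have h : ∀ i : Fin (Nat.card Q + 1), ∃ L, ∀ l, L ≤ l →
      ∃ q ∈ A.peel w (2 * i + 1) l, q ∉ A.peel w (2 * i + 2) l := fun i =>
    exists_forall_mem_peel_diff hw i
      ⟨j, hne.mono (peel_antitone j (by have := i.2; lia))⟩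
  choose L hL using h
  choose g hg hg' using fun i => hL i (Finset.univ.sup L) (Finset.le_sup (Finset.mem_univ i))
  have hlt : ∀ i i', i < i' → g i ≠ g i' := fun i i' hii' heq =>
    hg' i (heq ▸ peel_antitone _ (by have : (i : ℕ) < i' := hii'; lia) (hg i'))
  have hinj : Function.Injective g := fun i i' heq => by
    rcases lt_trichotomy i i' with h | h | h
    · exact absurd heq (hlt _ _ h)
    · exact h
    · exact absurd heq.symm (hlt _ _ h)
  simpa using Nat.card_le_card_of_injective g hinj

theorem runRank_le_iff (hw : w ∉ A.lang) {j k : ℕ} {q : Q} :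
    A.runRank w j q ≤ k ↔ q ∉ A.peel w (k + 1) j := by
  have hne : {k | q ∉ A.peel w (k + 1) j}.Nonempty :=
    ⟨2 * Nat.card Q, by simp [peel_eq_empty hw]⟩
  exact ⟨fun h hq => Nat.sInf_mem hne (peel_antitone j (Nat.succ_le_succ h) hq),
    fun h => Nat.sInf_le h⟩

theorem lt_runRank_iff (hw : w ∉ A.lang) {j k : ℕ} {q : Q} :
    k < A.runRank w j q ↔ q ∈ A.peel w (k + 1) j := by
  rw [← not_le, runRank_le_iff hw, not_not]

theorem runRank_eq_succ_iff (hw : w ∉ A.lang) {j k : ℕ} {q : Q} :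
    A.runRank w j q = k + 1 ↔ q ∈ A.peel w (k + 1) j ∧ q ∉ A.peel w (k + 2) j := by
  rw [← lt_runRank_iff hw, ← runRank_le_iff hw]
  lia

theorem runRank_eq_zero {j : ℕ} {q : Q} (hq : q ∉ A.level w j) : A.runRank w j q = 0 :=
  Nat.sInf_eq_zero.2 (.inl fun h => hq (peel_subset_level _ _ h))

theorem runRank_le_of_succ (hw : w ∉ A.lang) {j : ℕ} {q q' : Q} (hq : q ∈ A.level w j)
    (h : q' ∈ A.δ q (w j)) : A.runRank w (j + 1) q' ≤ A.runRank w j q := by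
  rw [runRank_le_iff hw]
  exact fun hq' => (runRank_le_iff hw).1 le_rfl (mem_peel_of_succ _ hq h hq')

theorem even_runRank (hw : w ∉ A.lang) {j : ℕ} {q : Q} (hq : q ∈ A.F) :
    Even (A.runRank w j q) := by
  by_contra h
  obtain ⟨i, hi⟩ := Nat.not_even_iff_odd.1 h
  obtain ⟨h1, h2⟩ := (runRank_eq_succ_iff hw).1 hi
  rw [peel_even] at h2
  exact h2 ⟨0, h1, hq⟩

/-- No path has constant even rank. -/
theorem not_isPathIn_runRank_even (hw : w ∉ A.lang) {i j : ℕ} (hi : Even i) {ρ : ℕ → Q} :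
    ¬ A.IsPathIn w (fun k => A.level w k ∩ A.runRank w k ⁻¹' {i}) j ρ := by
  intro h
  obtain ⟨i, rfl⟩ := hi.two_dvd
  refine (runRank_le_iff hw).1 (h j le_rfl).1.2.le ?_
  rw [peel_odd]
  refine ⟨ρ, rfl, fun k hk => ⟨?_, (h k hk).2⟩⟩
  obtain ⟨⟨h1, h2⟩, -⟩ := h k hk
  rcases i with - | i
  · exact h1
  · exact (lt_runRank_iff hw (k := 2 * i + 1)).1 (by have : _ = _ := h2; lia)

/-- An odd graph and the even graph before it are eventually empty together. -/
theorem exists_peel_eq_empty (i : ℕ) (h : ∀ j, A.peel w (2 * i + 1) j = ∅) :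
    ∃ L, ∀ l, L ≤ l → A.peel w (2 * i) l = ∅ := by
  have hpred : ∀ k, ∀ q' ∈ A.peel w (2 * i) (k + 1), ∃ q ∈ A.peel w (2 * i) k,
      q' ∈ A.δ q (w k) := fun k q' hq' => by
    obtain ⟨q, hq, hqq'⟩ := exists_mem_of_mem_level_succ (peel_subset_level _ _ hq')
    exact ⟨q, mem_peel_of_succ _ hq hqq' hq', hqq'⟩
  obtain ⟨L, hL⟩ : ∃ L, A.peel w (2 * i) L = ∅ := by
    by_contra! hne
    obtain ⟨ρ, hρ⟩ := exists_path_of_forall_nonempty (j := 0) (fun k _ => hne k)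
      fun k _ => hpred k
    have hmem : ρ 0 ∈ A.peel w (2 * i + 1) 0 := by
      rw [peel_odd]
      exact ⟨ρ, rfl, hρ⟩
    simp [h] at hmem
  refine ⟨L, fun l hl => ?_⟩
  induction l, hl using Nat.le_induction with
  | base => exact hL
  | succ l hl ih =>
    refine Set.eq_empty_of_forall_notMem fun q' hq' => ?_
    obtain ⟨q, hq, -⟩ := hpred l q' hq'
    simp [ih] at hq

/-- From some level on, the ranks of a rejected word form tight rankings of constant rank. -/
theorem exists_isTight_runRank (hA : A.Complete) (hI : A.I.Nonempty) (hw : w ∉ A.lang) :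
    ∃ L r, ∀ l, L ≤ l → A.IsTight (A.level w l) (A.runRank w l) ∧
      rankOf (A.runRank w l) = r := by
  classical
  have := A.finite
  have hex : ∃ i, ∀ j, A.peel w (2 * i + 1) j = ∅ := ⟨_, peel_eq_empty hw⟩
  obtain ⟨m, hm⟩ : ∃ m, Nat.find hex = m + 1 := by
    refine ⟨Nat.find hex - 1, (Nat.succ_pred_eq_of_ne_zero fun h0 => ?_).symm⟩
    have h := Nat.find_spec hex
    rw [h0] at h
    obtain ⟨q, hq⟩ := hI
    obtain ⟨ρ, -, hρ⟩ := exists_seq_of_step (j := 0) (P := fun k q => q ∈ A.level w k)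
      (R := fun k q q' => q' ∈ A.δ q (w k)) hq fun k q _ hq =>
        (hA q (w k)).imp fun q' h => ⟨mem_level_succ hq h, h⟩
    have hmem : ρ 0 ∈ A.peel w (2 * 0 + 1) 0 := by
      rw [peel_odd]
      exact ⟨ρ, rfl, hρ⟩
    simp only [h, Set.mem_empty_iff_false] at hmem
  have hempty := Nat.find_spec hex
  rw [hm] at hempty
  have hodd : ∀ i : Fin (m + 1), ∃ j, (A.peel w (2 * i + 1) j).Nonempty := fun i => by
    have := Nat.find_min hex (m := i) (by lia)
    by_contra! hcon
    exact this hcon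
  choose L hL using fun i : Fin (m + 1) => exists_forall_mem_peel_diff hw i (hodd i)
  obtain ⟨L', hL'⟩ := exists_peel_eq_empty _ hempty
  refine ⟨max L' (Finset.univ.sup L), 2 * m + 1, fun l hl => ?_⟩
  have hle : ∀ q, A.runRank w l q ≤ 2 * m + 1 := fun q => by
    rw [runRank_le_iff hw]
    exact Set.eq_empty_iff_forall_notMem.1 (hL' l ((le_max_left _ _).trans hl)) q
  have hmem : ∀ i ≤ m, ∃ q ∈ A.level w l, A.runRank w l q = 2 * i + 1 := fun i hi => by
    obtain ⟨q, h1, h2⟩ := hL ⟨i, Nat.lt_succ_of_le hi⟩ l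
      ((Finset.le_sup (Finset.mem_univ _)).trans ((le_max_right _ _).trans hl))
    exact ⟨q, peel_subset_level _ _ h1, (runRank_eq_succ_iff hw).2 ⟨h1, h2⟩⟩
  have hrank : rankOf (A.runRank w l) = 2 * m + 1 := by
    obtain ⟨q, -, hq⟩ := hmem m le_rfl
    have : Nonempty Q := ⟨q⟩
    exact le_antisymm (ciSup_le hle) (hq ▸ le_ciSup (Set.finite_range _).bddAbove q)
  refine ⟨⟨⟨fun q => ?_, fun q hq => even_runRank hw hq⟩, by simp [hrank], ?_,
    fun q hq => runRank_eq_zero hq⟩, hrank⟩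
  · simp [runRank_le_iff hw, peel_eq_empty hw]
  · rintro _ ⟨⟨i, rfl⟩, hi⟩
    exact hmem i (by lia)

/-! ### Delayed simulation and ranks -/

theorem respond_succ' (σ : Q → Q → α → Q → Q) (r : Q) (w : ℕ → α) (π : ℕ → Q) (k : ℕ) :
    respond σ r w π (k + 1) =
      respond σ (σ r (π 0) (w 0) (π 1)) (fun k => w (k + 1)) (fun k => π (k + 1)) k := by
  induction k with
  | zero => rfl
  | succ k ih => rw [respond, ih]; rfl

/-- The pairs from which a fixed strategy wins are closed under the moves of the game. -/
theorem WinsDelayed.step {σ : Q → Q → α → Q → Q} {p q p' : Q} {a : α}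
    (h : A.WinsDelayed σ p q) (hp : p' ∈ A.δ p a) : A.WinsDelayed σ p' (σ q p a p') := by
  rintro w π rfl hπ j hj
  obtain ⟨k, hk, hF⟩ := h (fun k => k.casesOn a w) (fun k => k.casesOn p π) rfl
    (fun k => by cases k; exacts [hp, hπ _]) (j + 1) hj
  obtain ⟨k, rfl⟩ : ∃ l, k = l + 1 := ⟨k - 1, by lia⟩
  rw [respond_succ'] at hF
  exact ⟨k, by lia, hF⟩

/-- The play of a winning strategy against a path from level `j` on, indexed by levels. -/
theorem WinsDelayed.exists_response {σ : Q → Q → α → Q → Q} (hσ : A.IsStrategy σ) {j : ℕ}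
    {q : Q} {ρ : ℕ → Q} (h : A.WinsDelayed σ (ρ j) q)
    (hρ : ∀ k, j ≤ k → ρ (k + 1) ∈ A.δ (ρ k) (w k)) :
    ∃ τ : ℕ → Q, τ j = q ∧ (∀ k, j ≤ k → τ (k + 1) ∈ A.δ (τ k) (w k)) ∧
      (∀ k, j ≤ k → A.WinsDelayed σ (ρ k) (τ k)) ∧
      ∀ k, j ≤ k → ρ k ∈ A.F → ∃ l, k ≤ l ∧ τ l ∈ A.F := by
  let s := respond σ q (fun k => w (j + k)) fun k => ρ (j + k)
  have hwin : ∀ n, A.WinsDelayed σ (ρ (j + n)) (s n) := fun n => by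
    induction n with
    | zero => exact h
    | succ n ih => exact ih.step (hρ (j + n) (by lia))
  refine ⟨fun k => s (k - j), by simp [s, respond], fun k hk => ?_, fun k hk => ?_,
    fun k hk hF => ?_⟩
  all_goals obtain ⟨n, rfl⟩ := Nat.exists_eq_add_of_le hk
  · simp only [Nat.add_sub_cancel_left, show j + n + 1 - j = n + 1 by lia]
    exact hσ _ _ _ _
  · simpa using hwin n
  · obtain ⟨l, hl, hF'⟩ := h (fun k => w (j + k)) (fun k => ρ (j + k)) rfl
      (fun k => hρ (j + k) (by lia)) n hF
    exact ⟨j + l, by lia, by simpa using hF'⟩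

/-- A vertex that is removed before an odd graph delay-simulates only vertices that are removed
before it. -/
theorem WinsDelayed.mem_peel {σ : Q → Q → α → Q → Q} (hσ : A.IsStrategy σ) (i : ℕ) {j : ℕ}
    {p q : Q} (h : A.WinsDelayed σ p q) (hq : q ∈ A.level w j)
    (hp : p ∈ A.peel w (2 * i + 1) j) : q ∈ A.peel w (2 * i + 1) j := by
  induction i generalizing j p q with
  | zero =>
    rw [peel_odd] at hp ⊢
    obtain ⟨ρ, rfl, hρ⟩ := hp
    obtain ⟨τ, rfl, hτ, -, -⟩ := h.exists_response hσ fun k hk => (hρ k hk).2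
    exact ⟨τ, rfl, fun k hk => ⟨mem_level_of_path hq hτ hk, hτ k hk⟩⟩
  | succ i ih =>
    -- Spoiler first stays in the odd graph until the answer has left the even graph before it.
    have hp1 := hp
    rw [peel_odd] at hp1
    obtain ⟨ρ, rfl, hρ⟩ := exists_path_infinitePart hp1
    rw [← peel_odd] at hρ
    obtain ⟨τ, rfl, hτ, hwin, -⟩ := h.exists_response hσ fun k hk => (hρ k hk).2
    rw [peel_odd]
    refine ⟨τ, rfl, fun k hk => ⟨?_, hτ k hk⟩⟩
    have hk' : ρ k ∈ A.peel w (2 * i + 2) k := peel_succ_subset _ _ (hρ k hk).1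
    rw [peel_even] at hk'
    obtain ⟨n, hn⟩ := hk'
    -- Spoiler then moves to an accepting state within the previous odd graph and stays in it.
    rw [peel_odd] at hn
    obtain ⟨ρ', hρ'0, hF, hρ'⟩ := hn.exists_path
    rw [← peel_odd] at hρ'
    have hτk := mem_level_of_path hq hτ hk
    have hwk := hwin k hk
    rw [← hρ'0] at hwk
    obtain ⟨τ', hτ'0, hτ', hwin', hacc⟩ := hwk.exists_response hσ fun k hk => (hρ' k hk).2
    obtain ⟨l, hl, hFl⟩ := hacc (k + n) (by lia) hF
    rw [← hτ'0] at hτk ⊢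
    have hkl : k ≤ l := by lia
    have hmem := ih (hwin' l hkl) (mem_level_of_path hτk hτ' hkl) (hρ' l hkl).1
    refine mem_peel_of_path (2 * i + 2) hτk hτ' hkl ?_
    rw [peel_even]
    exact ⟨0, hmem, hFl⟩

theorem runRank_le_evenCeil (hw : w ∉ A.lang) {j : ℕ} {p q : Q} (h : A.DelayedSim p q)
    (hq : q ∈ A.level w j) : A.runRank w j p ≤ evenCeil (A.runRank w j q) := by
  obtain ⟨σ, hσ, hwin⟩ := h
  obtain ⟨i, hi, hle⟩ : ∃ i, evenCeil (A.runRank w j q) = 2 * i ∧ A.runRank w j q ≤ 2 * i := by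
    unfold evenCeil
    split_ifs with he
    · obtain ⟨i, hi⟩ := he.two_dvd
      exact ⟨i, hi, hi.le⟩
    · obtain ⟨i, hi⟩ := Nat.not_even_iff_odd.1 he
      exact ⟨i + 1, by lia, by lia⟩
  rw [hi, runRank_le_iff hw]
  exact fun hp => (runRank_le_iff hw).1 hle (hwin.mem_peel hσ i hq hp)

/-! ### Rejected words are accepted by the construction -/

theorem mem_rankConstruction_lang_of_I_eq_empty {R : Set (RankState Q)} (hR : R ⊆ A.Q2)
    (hI : A.I = ∅) : w ∈ (A.rankConstruction R hR).lang := by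
  have hlevel : ∀ j, A.level w j = ∅ := fun j => by
    induction j with
    | zero => exact hI
    | succ j ih => simp [level, post, ih]
  refine Set.mem_biUnion (x := .inl A.I) rfl
    ⟨fun j => .inl (A.level w j), rfl, fun j => rfl, isAccepting_of_frequently fun k => ?_⟩
  exact ⟨k, le_rfl, hlevel k⟩

/-- An accepting run that moves from level `L` to the part with rankings. -/
theorem mem_rankConstruction_lang {R : Set (RankState Q)} (hR : R ⊆ A.Q2) (L : ℕ)
    (M : ℕ → RankState Q) (hM : ∀ k, M k ∈ R) (h2 : A.Step2 (A.level w L) (w L) (M 0))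
    (h3 : ∀ k, A.Step3 (M k) (w (L + 1 + k)) (M (k + 1)))
    (hO : ∀ k, ∃ l, k ≤ l ∧ (M l).O = ∅) : w ∈ (A.rankConstruction R hR).lang := by
  let ρ : ℕ → Set Q ⊕ R := fun j =>
    if j ≤ L then .inl (A.level w j) else .inr ⟨M (j - (L + 1)), hM _⟩
  have hl : ∀ j, j ≤ L → ρ j = .inl (A.level w j) := fun j hj => if_pos hj
  have hr : ∀ k, ρ (L + 1 + k) = .inr ⟨M k, hM k⟩ := fun k => by
    simp only [ρ, if_neg (show ¬ L + 1 + k ≤ L by lia), Nat.add_sub_cancel_left]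
  refine Set.mem_biUnion (x := .inl A.I) rfl ⟨ρ, hl 0 L.zero_le, fun j => ?_,
    isAccepting_of_frequently fun k => ?_⟩
  · rcases lt_trichotomy j L with h | rfl | h
    · rw [hl j h.le, hl (j + 1) h]
      rfl
    · rw [hl j le_rfl, show j + 1 = j + 1 + 0 from rfl, hr 0]
      exact h2
    · obtain ⟨k, rfl⟩ := Nat.exists_eq_add_of_le (show L + 1 ≤ j from h)
      rw [hr k, add_assoc (L + 1), hr (k + 1)]
      exact h3 k
  · obtain ⟨l, hkl, hl⟩ := hO k
    refine ⟨L + 1 + l, by lia, ?_⟩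
    rw [hr l]
    exact hl

open Classical in
/-- The macrostates of the part with rankings along `w`, entered on level `L`, when the ranks of
the vertices of the run graph are used as rankings. -/
noncomputable def rankRun (A : BA α Q) (w : ℕ → α) (L : ℕ) : ℕ → RankState Q
  | 0 => ⟨A.level w L, ∅, A.runRank w L, 0⟩
  | k + 1 =>
    let M := rankRun A w L k
    let f := A.runRank w (L + (k + 1))
    let i := if M.O = ∅ then (M.i + 2) % (rankOf f + 1) else M.i
    ⟨A.level w (L + (k + 1)),
      (if M.O = ∅ then A.level w (L + (k + 1)) else A.post M.O (w (L + k))) ∩ f ⁻¹' {i}, f, i⟩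

theorem rankRun_S (L k : ℕ) : (A.rankRun w L k).S = A.level w (L + k) := by
  cases k <;> rfl

theorem rankRun_f (L k : ℕ) : (A.rankRun w L k).f = A.runRank w (L + k) := by
  cases k <;> rfl

theorem rankRun_i_of_empty {L k : ℕ} (h : (A.rankRun w L k).O = ∅) :
    (A.rankRun w L (k + 1)).i =
      ((A.rankRun w L k).i + 2) % (rankOf (A.runRank w (L + (k + 1))) + 1) :=
  if_pos h

theorem rankRun_i_of_ne {L k : ℕ} (h : (A.rankRun w L k).O ≠ ∅) :
    (A.rankRun w L (k + 1)).i = (A.rankRun w L k).i :=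
  if_neg h

theorem rankRun_O_of_empty {L k : ℕ} (h : (A.rankRun w L k).O = ∅) :
    (A.rankRun w L (k + 1)).O = A.level w (L + (k + 1)) ∩
      A.runRank w (L + (k + 1)) ⁻¹' {(A.rankRun w L (k + 1)).i} :=
  congrArg₂ (· ∩ ·) (if_pos h) rfl

theorem rankRun_O_of_ne {L k : ℕ} (h : (A.rankRun w L k).O ≠ ∅) :
    (A.rankRun w L (k + 1)).O = A.post (A.rankRun w L k).O (w (L + k)) ∩
      A.runRank w (L + (k + 1)) ⁻¹' {(A.rankRun w L k).i} := by
  rw [← rankRun_i_of_ne h]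
  exact congrArg₂ (· ∩ ·) (if_neg h) rfl

theorem rankRun_O_subset (L k : ℕ) :
    (A.rankRun w L k).O ⊆
      A.level w (L + k) ∩ A.runRank w (L + k) ⁻¹' {(A.rankRun w L k).i} := by
  induction k with
  | zero => exact Set.empty_subset _
  | succ k ih =>
    by_cases h : (A.rankRun w L k).O = ∅
    · exact (rankRun_O_of_empty h).le
    · rw [rankRun_O_of_ne h, rankRun_i_of_ne h]
      exact Set.inter_subset_inter_left _ (Set.biUnion_subset_biUnion_left fun q hq => (ih hq).1)

theorem rankRun_i {L r : ℕ} (hr : Odd r) (hrank : ∀ l, L ≤ l → rankOf (A.runRank w l) = r)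
    (k : ℕ) : Even (A.rankRun w L k).i ∧ (A.rankRun w L k).i < r := by
  have hr1 : Even (r + 1) := hr.add_one
  induction k with
  | zero => exact ⟨Even.zero, hr.pos⟩
  | succ k ih =>
    by_cases h : (A.rankRun w L k).O = ∅
    · rw [rankRun_i_of_empty h, hrank _ (by lia)]
      have he : Even (((A.rankRun w L k).i + 2) % (r + 1)) :=
        (ih.1.add even_two).mod_even hr1
      refine ⟨he, lt_of_le_of_ne (Nat.le_of_lt_succ (Nat.mod_lt _ (by lia))) fun heq => ?_⟩
      rw [heq] at he
      exact Nat.not_even_iff_odd.2 hr he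
    · rwa [rankRun_i_of_ne h]

/-- The run through the canonical ranks never leaves `A.Q2de`, so every larger set of macrostates
is complete for the rejected words. -/
theorem compl_lang_subset (hA : A.Complete) {R : Set (RankState Q)} (hR : R ⊆ A.Q2)
    (hR' : A.Q2de ⊆ R) : (A.lang)ᶜ ⊆ (A.rankConstruction R hR).lang := by
  have := A.finite
  intro w hw
  rcases A.I.eq_empty_or_nonempty with hI | hI
  · exact mem_rankConstruction_lang_of_I_eq_empty hR hI
  obtain ⟨L, r, hL⟩ := exists_isTight_runRank hA hI hw
  have htight : ∀ k, A.IsTight (A.rankRun w (L + 1) k).S (A.rankRun w (L + 1) k).f := fun k => by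
    rw [rankRun_S, rankRun_f]
    exact (hL _ (by lia)).1
  have hrank : ∀ l, L + 1 ≤ l → rankOf (A.runRank w l) = r := fun l hl => (hL l (by lia)).2
  have hodd : Odd r := hrank (L + 1) le_rfl ▸ (hL (L + 1) (by lia)).1.odd_rank
  have hi := rankRun_i hodd hrank
  have hrn : r ≤ 2 * Nat.card Q := by
    rw [← hrank (L + 1) le_rfl]
    exact ciSup_le' (hL (L + 1) (by lia)).1.isRanking.1
  refine mem_rankConstruction_lang hR L (A.rankRun w (L + 1)) (fun k => hR' ⟨⟨?_, (hi k).1,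
    (hi k).2.trans_le hrn, htight k, ?_⟩, ?_⟩) ⟨rfl, rfl, rfl, htight 0⟩ (fun k => ?_) fun k => ?_
  · have h := htight k
    exact ⟨h.isRanking, h.odd_rank, h.odd_subset.trans (Set.image_mono (Set.subset_univ _)),
      fun q hq => absurd trivial hq⟩
  · rw [rankRun_S, rankRun_f]
    exact rankRun_O_subset _ _
  · rintro ⟨p, hp, q, hq, hpq, hlt⟩
    rw [rankRun_f] at hlt
    rw [rankRun_S] at hq
    exact hlt.not_ge (runRank_le_evenCeil hw hpq hq)
  · refine ⟨?_, ?_, ?_, htight (k + 1), ?_⟩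
    · rw [rankRun_S, rankRun_S]
      rfl
    · rw [rankRun_S, rankRun_f, rankRun_f]
      exact fun q hq q' hq' => runRank_le_of_succ hw hq hq'
    · rw [rankRun_f, rankRun_f, hrank _ (by lia), hrank _ (by lia)]
    · rw [rankRun_f, rankRun_S]
      by_cases h : (A.rankRun w (L + 1) k).O = ∅
      · exact .inl ⟨h, rankRun_i_of_empty h, rankRun_O_of_empty h⟩
      · exact .inr ⟨h, rankRun_i_of_ne h, rankRun_O_of_ne h⟩
  · -- If `O` were never emptied again, König's lemma would yield a path of constant even rank.
    by_contra! hne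
    have hik : ∀ l, k ≤ l → (A.rankRun w (L + 1) l).i = (A.rankRun w (L + 1) k).i :=
      fun l hl => by
        induction l, hl using Nat.le_induction with
        | base => rfl
        | succ l hl ih => rw [rankRun_i_of_ne (hne l hl).ne_empty, ih]
    obtain ⟨ρ, hρ⟩ := exists_path_of_forall_nonempty (A := A) (w := w)
      (X := fun m => (A.rankRun w (L + 1) (m - (L + 1))).O) (j := L + 1 + k)
      (fun m hm => hne _ (by lia)) fun m hm q' hq' => by
        obtain ⟨l, rfl⟩ := Nat.exists_eq_add_of_le (show L + 1 ≤ m by lia)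
        rw [show L + 1 + l + 1 - (L + 1) = l + 1 by lia,
          rankRun_O_of_ne (hne l (by lia)).ne_empty] at hq'
        simpa [post] using hq'.1
    refine not_isPathIn_runRank_even hw (hi k).1 (j := L + 1 + k) (ρ := ρ) fun m hm => ?_
    obtain ⟨h1, h2⟩ := hρ m hm
    have h3 := rankRun_O_subset _ _ h1
    rw [hik _ (by lia), show L + 1 + (m - (L + 1)) = m by lia] at h3
    exact ⟨h3, h2⟩

/-! ### Accepted words are rejected by the construction -/

/-- A run of the construction either stays in the subset part, or follows it up to some level and
then the part with rankings. -/
theorem rankConstruction_trace_cases {R : Set (RankState Q)} {hR : R ⊆ A.Q2}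
    {X : ℕ → Set Q ⊕ R} (h0 : X 0 = .inl A.I) (hX : (A.rankConstruction R hR).IsTrace w X) :
    (∀ j, X j = .inl (A.level w j)) ∨
      ∃ (L : ℕ) (M : ℕ → RankState Q) (hM : ∀ k, M k ∈ R),
        (∀ k, X (L + 1 + k) = .inr ⟨M k, hM k⟩) ∧ A.Step2 (A.level w L) (w L) (M 0) ∧
        ∀ k, A.Step3 (M k) (w (L + 1 + k)) (M (k + 1)) := by
  classical
  by_cases h : ∀ j, X j = .inl (A.level w j)
  · exact .inl h
  push Not at h
  right
  obtain ⟨L, hL⟩ : ∃ L, Nat.find h = L + 1 := by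
    refine ⟨Nat.find h - 1, (Nat.succ_pred_eq_of_ne_zero fun hz => ?_).symm⟩
    exact Nat.find_spec h (hz ▸ h0)
  have hXL : X L = .inl (A.level w L) := not_not.1 (Nat.find_min h (by lia))
  have hXL1 : X (L + 1) ≠ .inl (A.level w (L + 1)) := hL ▸ Nat.find_spec h
  have hstep := hX L
  rw [hXL] at hstep
  have hM : ∀ k, ∃ M : R, X (L + 1 + k) = .inr M := fun k => by
    induction k with
    | zero =>
      cases hc : X (L + 1) with
      | inl S =>
        rw [hc] at hstep hXL1
        exact absurd (congrArg Sum.inl hstep) hXL1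
      | inr M => exact ⟨M, rfl⟩
    | succ k ih =>
      obtain ⟨M, hM⟩ := ih
      have hs := hX (L + 1 + k)
      rw [hM] at hs
      cases hc : X (L + 1 + (k + 1)) with
      | inl S =>
        rw [add_assoc (L + 1), hc] at hs
        exact hs.elim
      | inr M' => exact ⟨M', rfl⟩
  choose M hM using hM
  refine ⟨L, fun k => M k, fun k => (M k).2, hM, ?_, fun k => ?_⟩
  · rw [show L + 1 = L + 1 + 0 from rfl, hM 0] at hstep
    exact hstep
  · have hs := hX (L + 1 + k)
    rw [add_assoc (L + 1), hM k, hM (k + 1)] at hs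
    exact hs

/-- A sequence of macrostates that empties `O` infinitely often has, after any time, a moment at
which `O` is the set of all states of rank `c`, for each even `c` below the common rank: the
parameter `i` cycles through all even numbers below the rank. -/
theorem exists_reset {M : ℕ → RankState Q} {v : ℕ → α} {r : ℕ} (hr : Odd r)
    (hrank : ∀ k, rankOf (M k).f = r) (h3 : ∀ k, A.Step3 (M k) (v k) (M (k + 1)))
    (hO : ∀ k, ∃ l, k ≤ l ∧ (M l).O = ∅) (hi : ∀ k, Even (M k).i) {c : ℕ} (hc : Even c)
    (hcr : c ≤ r) (N : ℕ) :
    ∃ k, N ≤ k ∧ (M k).i = c ∧ (M k).O = (M k).S ∩ (M k).f ⁻¹' {c} := by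
  classical
  -- From any moment on, `i` is kept up to the next moment with empty `O`.
  have hnext : ∀ k, ∃ l, k ≤ l ∧ (M l).O = ∅ ∧ (M l).i = (M k).i := fun k => by
    have hlt := Nat.find_spec (hO k)
    refine ⟨Nat.find (hO k), hlt.1, hlt.2, ?_⟩
    have : ∀ l, k ≤ l → l ≤ Nat.find (hO k) → (M l).i = (M k).i := fun l hl => by
      induction l, hl using Nat.le_induction with
      | base => exact fun _ => rfl
      | succ l hl ih =>
        intro hle
        rcases (h3 l).2.2.2.2 with ⟨h, -⟩ | ⟨-, h, -⟩
        · exact absurd ⟨hl, h⟩ (Nat.find_min (hO k) (by lia))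
        · rw [h, ih (by lia)]
    exact this _ hlt.1 le_rfl
  have hcycle : ∀ t, ∃ k, N ≤ k ∧ (M k).i = ((M N).i + 2 * (t + 1)) % (r + 1) ∧
      (M k).O = (M k).S ∩ (M k).f ⁻¹' {(M k).i} := fun t => by
    have hstep : ∀ k, (M k).O = ∅ → (M (k + 1)).i = ((M k).i + 2) % (r + 1) ∧
        (M (k + 1)).O = (M (k + 1)).S ∩ (M (k + 1)).f ⁻¹' {(M (k + 1)).i} := fun k hk => by
      rcases (h3 k).2.2.2.2 with ⟨-, h1, h2⟩ | ⟨h, -⟩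
      · rw [hrank] at h1
        exact ⟨h1, h2⟩
      · exact absurd hk h
    induction t with
    | zero =>
      obtain ⟨l, hl, hlO, hli⟩ := hnext N
      have := hstep l hlO
      rw [hli] at this
      exact ⟨l + 1, by lia, this⟩
    | succ t ih =>
      obtain ⟨k, hk, hki, -⟩ := ih
      obtain ⟨l, hl, hlO, hli⟩ := hnext k
      have := hstep l hlO
      rw [hli, hki, Nat.mod_add_mod, add_assoc] at this
      exact ⟨l + 1, by lia, this⟩
  -- The number of steps that lead from the current value to `c`, going once around.
  obtain ⟨a, ha⟩ := hc.two_dvd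
  obtain ⟨b, hb⟩ := (hi N).two_dvd
  obtain ⟨m, hm⟩ := hr
  obtain ⟨k, hk, hki, hkO⟩ := hcycle (a + b * (m + 1) + m - b)
  have hbm : b ≤ b * (m + 1) := Nat.le_mul_of_pos_right b (by lia)
  have hsum : (M N).i + 2 * (a + b * (m + 1) + m - b + 1) = c + (r + 1) * (b + 1) := by
    rw [hb, ha, hm]
    zify [show b ≤ a + b * (m + 1) + m by lia]
    ring
  rw [hsum, Nat.add_mul_mod_self_left, Nat.mod_eq_of_lt (by lia)] at hki
  rw [hki] at hkO
  exact ⟨k, hk, hki, hkO⟩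

/-- The macrostates with rankings along an accepted word empty `O` only finitely often: the rank
of an accepting run stabilizes at an even number `c`, and once `i` is `c`, the run is kept in
`O`. -/
theorem not_frequently_empty {M : ℕ → RankState Q} {v : ℕ → α} (hM : ∀ k, M k ∈ A.Q2)
    (h3 : ∀ k, A.Step3 (M k) (v k) (M (k + 1))) {ρ : ℕ → Q} (h0 : ρ 0 ∈ (M 0).S)
    (hρ : A.IsTrace v ρ) (hF : ∀ k, ∃ l, k ≤ l ∧ ρ l ∈ A.F) :
    ¬ ∀ k, ∃ l, k ≤ l ∧ (M l).O = ∅ := by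
  intro hO
  have := A.finite
  have hS : ∀ k, ρ k ∈ (M k).S := fun k => by
    induction k with
    | zero => exact h0
    | succ k ih =>
      rw [(h3 k).1]
      exact Set.mem_biUnion ih (hρ k)
  have hrank : ∀ k, rankOf (M k).f = rankOf (M 0).f := fun k => by
    induction k with
    | zero => rfl
    | succ k ih => rw [← (h3 k).2.2.1, ih]
  have hanti : Antitone fun k => (M k).f (ρ k) :=
    antitone_nat_of_succ_le fun k => (h3 k).2.1 _ (hS k) _ (hρ k)
  obtain ⟨N, hN⟩ := WellFoundedGT.monotone_chain_condition (α := ℕᵒᵈ)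
    ⟨fun k => OrderDual.toDual ((M k).f (ρ k)), hanti⟩
  replace hN : ∀ k, N ≤ k → (M N).f (ρ N) = (M k).f (ρ k) := hN
  have heven : Even ((M N).f (ρ N)) := by
    obtain ⟨l, hl, hlF⟩ := hF N
    rw [hN l hl]
    exact (hM l).1.isRanking.2 _ hlF
  obtain ⟨k, hk, hki, hkO⟩ := exists_reset (hM 0).1.odd_rank hrank h3 hO (fun k => (hM k).2.1)
    heven (by rw [← hrank N]; exact le_ciSup (Set.finite_range _).bddAbove _) N
  have hkeep : ∀ l, k ≤ l → (M l).i = (M N).f (ρ N) ∧ ρ l ∈ (M l).O := fun l hl => by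
    induction l, hl using Nat.le_induction with
    | base =>
      rw [hkO]
      exact ⟨hki, hS k, (hN k hk).symm⟩
    | succ l hl ih =>
      rcases (h3 l).2.2.2.2 with ⟨h, -⟩ | ⟨-, h1, h2⟩
      · exact absurd ih.2 (by simp [h])
      · rw [h1, h2, ih.1]
        exact ⟨rfl, Set.mem_biUnion ih.2 (hρ l), (hN _ (by lia)).symm⟩
  obtain ⟨l, hl, hlO⟩ := hO k
  exact absurd (hkeep l hl).2 (by simp [hlO])

theorem rankConstruction_lang_subset {R : Set (RankState Q)} (hR : R ⊆ A.Q2) :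
    (A.rankConstruction R hR).lang ⊆ (A.lang)ᶜ := by
  intro w hw hwA
  simp only [lang, Set.mem_iUnion] at hw hwA
  obtain ⟨x, hx, X, hX0, hX, hXacc⟩ := hw
  obtain ⟨q, hq, ρ, hρ0, hρ, hρacc⟩ := hwA
  obtain rfl : x = .inl A.I := hx
  have hlevel : ∀ j, ρ j ∈ A.level w j := fun j =>
    mem_level_of_path (j := 0) (by rw [hρ0]; exact hq) (fun k _ => hρ k) j.zero_le
  rcases rankConstruction_trace_cases hX0 hX with h | ⟨L, M, hM, hXM, h2, h3⟩
  · obtain ⟨l, -, hl⟩ := hXacc.frequently 0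
    rw [h l] at hl
    have : A.level w l = ∅ := hl
    exact absurd (hlevel l) (by simp [this])
  · refine not_frequently_empty (ρ := fun k => ρ (L + 1 + k)) (fun k => hR (hM k)) h3 ?_
      (fun k => hρ (L + 1 + k)) (fun k => ?_) fun k => ?_
    · rw [h2.1]
      exact hlevel (L + 1)
    · obtain ⟨l, hl, hlF⟩ := hρacc.frequently (L + 1 + k)
      exact ⟨l - (L + 1), by lia, by rwa [Nat.add_sub_cancel' (by lia)]⟩
    · obtain ⟨l, hl, hlF⟩ := hXacc.frequently (L + 1 + k)
      obtain ⟨m, rfl⟩ := Nat.exists_eq_add_of_le (show L + 1 ≤ l by lia)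
      rw [hXM m] at hlF
      exact ⟨m, by lia, hlF⟩

theorem rankConstruction_lang (hA : A.Complete) {R : Set (RankState Q)} (hR : R ⊆ A.Q2)
    (hR' : A.Q2de ⊆ R) : (A.rankConstruction R hR).lang = (A.lang)ᶜ :=
  (rankConstruction_lang_subset hR).antisymm (compl_lang_subset hA hR hR')

end BA

theorem lemma2 {α Q : Type*} [Finite α] [Nonempty α] (A : BA α Q) (hA : A.Complete) :
    A.purgeDe.lang = A.schewe.lang ∧ A.purgeDe.lang = (A.lang)ᶜ := by
  have h1 : A.purgeDe.lang = (A.lang)ᶜ := BA.rankConstruction_lang hA _ Set.Subset.rfl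
  have h2 : A.schewe.lang = (A.lang)ᶜ := BA.rankConstruction_lang hA _ Set.sdiff_subset
  exact ⟨h1.trans h2.symm, h1⟩
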